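/- **Theorem.** Let $\mathcal H$ be a separable complex Hilbert space. For a bounded operator $A$ on $\mathcal H$ put $|A|=(A^*A)^{1/2}$ and, for $0<p<\infty$, $\|A\|_p=(\operatorname{tr}|A|^p)^{1/p}\in[0,\infty]$; let $C_p$ be the set of all compact operators $A$ on $\mathcal H$ with $\|A\|_p<\infty$. Let $0<p<\infty$, let $n\ge 0$ be an integer, and let $A_1,\dots,A_n\in C_p$ be such that $\operatorname{ran}A_i\perp\operatorname{ran}A_j$ whenever $i\ne j$. Then $A_i\pm A_j\in C_p$ for all $i,j$, and the following holds, both with the upper sign throughout and with the lower sign throughout: if $0<p\le 2$, then $$\sum_{i,j=1}^n\|A_i\pm A_j\|_p^2\;\le\; 2\,n^{2/p-1}(n\pm1)\sum_{i=1}^n\|A_i\|_p^2 ;$$ if $2\le p<\infty$, then $$2\,n^{2/p-1}(n\pm1)\sum_{i=1}^n\|A_i\|_p^2\;\le\;\sum_{i,j=1}^n\|A_i\pm A_j\|_p^2 .$$ (For $n=0$ both sides are read as $0$.) -/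

import Mathlib

open scoped ENNReal InnerProductSpace

noncomputable section

variable {H : Type*} [NormedAddCommGroup H] [InnerProductSpace ℂ H]

/-- The diagonal sum `∑ ⟪T e, e⟫` of a positive operator along a Hilbert basis, in `[0, ∞]`. -/
def diagSum {ι : Type*} (b : HilbertBasis ι ℂ H) (T : H →L[ℂ] H) : ℝ≥0∞ :=
  ∑' i, ENNReal.ofReal (RCLike.re ⟪T (b i), b i⟫_ℂ)

/-- Parseval's identity. -/
theorem HilbertBasis.tsum_enorm_inner_sq {ι : Type*} (b : HilbertBasis ι ℂ H) (x : H) :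
    ∑' i, ‖⟪b i, x⟫_ℂ‖ₑ ^ 2 = ‖x‖ₑ ^ 2 := by
  have h := (b.hasSum_inner_mul_inner x x).mapL Complex.reCLM
  have h2 : HasSum (fun i => ‖⟪b i, x⟫_ℂ‖ ^ 2) (‖x‖ ^ 2) := by
    convert h using 1
    · funext i
      rw [← inner_conj_symm x (b i), RCLike.conj_mul]
      norm_cast
    · rw [inner_self_eq_norm_sq_to_K]
      norm_cast
  have h3 := ENNReal.ofReal_tsum_of_nonneg (fun i => sq_nonneg ‖⟪b i, x⟫_ℂ‖) h2.summable
  rw [h2.tsum_eq] at h3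
  simp only [← ofReal_norm, ← ENNReal.ofReal_pow (norm_nonneg _)]
  exact h3.symm

variable [CompleteSpace H]

/-- The diagonal sum of a positive operator does not depend on the Hilbert basis. -/
theorem diagSum_eq {ι κ : Type*} (b : HilbertBasis ι ℂ H) (c : HilbertBasis κ ℂ H)
    {T : H →L[ℂ] H} (hT : 0 ≤ T) : diagSum b T = diagSum c T := by
  obtain ⟨S, hS, hST⟩ : ∃ S : H →L[ℂ] H, IsSelfAdjoint S ∧ S * S = T :=
    ⟨CFC.sqrt T, (CFC.sqrt_nonneg T).isSelfAdjoint, CFC.sqrt_mul_sqrt_self T hT⟩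
  have hsym : ∀ x y, ⟪S x, y⟫_ℂ = ⟪x, S y⟫_ℂ := fun x y => hS.isSymmetric x y
  have key : ∀ x, ENNReal.ofReal (RCLike.re ⟪T x, x⟫_ℂ) = ‖S x‖ₑ ^ 2 := by
    intro x
    rw [← hST, mul_apply_eq_comp, hsym, inner_self_eq_norm_sq (𝕜 := ℂ),
      ENNReal.ofReal_pow (norm_nonneg _), ofReal_norm]
  unfold diagSum
  simp only [key]
  calc ∑' i, ‖S (b i)‖ₑ ^ 2 = ∑' i, ∑' j, ‖⟪c j, S (b i)⟫_ℂ‖ₑ ^ 2 := by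
        simp only [HilbertBasis.tsum_enorm_inner_sq]
    _ = ∑' j, ∑' i, ‖⟪c j, S (b i)⟫_ℂ‖ₑ ^ 2 := ENNReal.tsum_comm
    _ = ∑' j, ∑' i, ‖⟪b i, S (c j)⟫_ℂ‖ₑ ^ 2 := by
        refine tsum_congr fun j => tsum_congr fun i => ?_
        rw [← hsym, ← inner_conj_symm, RCLike.enorm_conj]
    _ = ∑' j, ‖S (c j)‖ₑ ^ 2 := by simp only [HilbertBasis.tsum_enorm_inner_sq]

/-- The trace `tr T ∈ [0, ∞]` of a positive operator `T`, computed along some Hilbert basis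
(by `diagSum_eq` its choice does not matter). -/
def posTrace (T : H →L[ℂ] H) : ℝ≥0∞ :=
  diagSum (exists_hilbertBasis ℂ H).choose_spec.choose T

theorem posTrace_eq_diagSum {ι : Type*} (b : HilbertBasis ι ℂ H) {T : H →L[ℂ] H} (hT : 0 ≤ T) :
    posTrace T = diagSum b T :=
  diagSum_eq _ b hT

/-- The Schatten `p`-norm `(tr |A| ^ p) ^ (1 / p)` (`0 < p < ∞`), with values in `[0, ∞]`;
here `|A| = (A* A) ^ (1 / 2)`. -/
def schattenENorm (p : ℝ) (A : H →L[ℂ] H) : ℝ≥0∞ :=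
  posTrace (CFC.abs A ^ p) ^ (1 / p)

/-- The Schatten `p`-norm as a real number, meaningful for operators in the Schatten class. -/
def schattenNorm (p : ℝ) (A : H →L[ℂ] H) : ℝ :=
  (schattenENorm p A).toReal

variable (H) in
/-- The Schatten `p`-class `C_p`: the compact operators with finite Schatten `p`-norm. -/
def schattenClass (p : ℝ) : Set (H →L[ℂ] H) :=
  {A | IsCompactOperator A ∧ schattenENorm p A < ∞}

end

open scoped ENNReal InnerProductSpace

noncomputable section

variable {H : Type*} [NormedAddCommGroup H] [InnerProductSpace ℂ H]

/-! Let `A`, `B` be compact with orthogonal ranges and `C = A + B`. Since `A* B = 0`, `C*` agrees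
with `A*` on `ran A`. So if `v i` are left singular vectors of `A` and `u k` those of `C`, with
singular values `s k`, the squared singular values of `A` are `‖C* (v i)‖² = ∑ k, |⟪u k, v i⟫|² (s
k)²`. By Bessel these weights sum over `k` to at most 1, so Jensen applies to `t ^ (p / 2)`, convex
or concave according to `p`. Summed over the left singular vectors of both `A` and `B`, the weights
at `k` add up to `‖u k‖²`, because `u k` lies in `ran A + ran B`. Hence `tr |A|^p + tr |B|^p ≤ tr |A
+ B|^p` for `2 ≤ p`, reversed for `p ≤ 2` (`posTrace_add_le_of_two_le`,
`posTrace_add_le_of_le_two`).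

Power means turn this into a bound for each pair with constant `2 ^ (2 / p - 1)`, which is compared
with `n ^ (2 / p - 1)` since a pair `i ≠ j` forces `2 ≤ n`. The diagonal contributes `4 ‖A i‖²` or
`0`, and the rest is counting. -/

/-! ### Jensen's inequality and left singular vectors -/

/-- Jensen's inequality for subprobability weights and the convex function `x ^ q`, `1 ≤ q`. -/
theorem ENNReal.rpow_tsum_mul_le {κ : Type*} {w : κ → ℝ≥0∞} (hw : ∑' k, w k ≤ 1) (f : κ → ℝ≥0∞)
    {q : ℝ} (hq : 1 ≤ q) : (∑' k, w k * f k) ^ q ≤ ∑' k, w k * f k ^ q := by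
  have hq0 : 0 < q := by positivity
  rw [← ENNReal.le_rpow_inv_iff hq0, ENNReal.tsum_eq_iSup_sum]
  refine iSup_le fun s => (ENNReal.inner_le_weight_mul_Lp_of_nonneg s hq w f).trans ?_
  calc (∑ k ∈ s, w k) ^ (1 - q⁻¹) * (∑ k ∈ s, w k * f k ^ q) ^ q⁻¹
      ≤ 1 ^ (1 - q⁻¹) * (∑' k, w k * f k ^ q) ^ q⁻¹ := by
        gcongr
        · rw [sub_nonneg]
          exact inv_le_one_of_one_le₀ hq
        · exact (ENNReal.sum_le_tsum s).trans hw
        · exact ENNReal.sum_le_tsum s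
    _ = _ := by rw [ENNReal.one_rpow, one_mul]

/-- Jensen's inequality for subprobability weights and the concave function `x ^ q`,
`0 < q ≤ 1`. -/
theorem ENNReal.tsum_mul_rpow_le {κ : Type*} {w : κ → ℝ≥0∞} (hw : ∑' k, w k ≤ 1) (f : κ → ℝ≥0∞)
    {q : ℝ} (hq0 : 0 < q) (hq : q ≤ 1) : ∑' k, w k * f k ^ q ≤ (∑' k, w k * f k) ^ q := by
  have h := ENNReal.rpow_tsum_mul_le hw (fun k => f k ^ q) (one_le_inv_iff₀.2 ⟨hq0, hq⟩)
  simp only [← ENNReal.rpow_mul, mul_inv_cancel₀ hq0.ne', ENNReal.rpow_one] at h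
  rwa [ENNReal.rpow_inv_le_iff hq0] at h

theorem enorm_inner_comm (x y : H) : ‖⟪x, y⟫_ℂ‖ₑ = ‖⟪y, x⟫_ℂ‖ₑ := by
  rw [← inner_conj_symm, RCLike.enorm_conj]

theorem ENNReal.sq_rpow_half (x : ℝ≥0∞) (p : ℝ) : (x ^ 2) ^ (p / 2) = x ^ p := by
  rw [← ENNReal.rpow_natCast, ← ENNReal.rpow_mul]
  congr 1
  push_cast
  ring

theorem enorm_add_sq_of_inner_eq_zero {x y : H} (h : ⟪x, y⟫_ℂ = 0) :
    ‖x + y‖ₑ ^ 2 = ‖x‖ₑ ^ 2 + ‖y‖ₑ ^ 2 := by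
  simp only [← ofReal_norm, ← ENNReal.ofReal_pow (norm_nonneg _)]
  rw [← ENNReal.ofReal_add (sq_nonneg _) (sq_nonneg _)]
  congr 1
  simpa only [sq] using norm_add_sq_eq_norm_sq_add_norm_sq_of_inner_eq_zero x y h

/-- The normalised images of a Hilbert basis (zero where the image vanishes). -/
def dirVec {ι : Type*} (A : H →L[ℂ] H) (b : HilbertBasis ι ℂ H) (i : ι) : H :=
  A ((‖A (b i)‖⁻¹ : ℂ) • b i)

section
variable {ι : Type*} {A : H →L[ℂ] H} {b : HilbertBasis ι ℂ H}

theorem norm_smul_dirVec (i : ι) : (‖A (b i)‖ : ℂ) • dirVec A b i = A (b i) := by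
  rcases eq_or_ne (A (b i)) 0 with h | h
  · simp [h]
  · have : (‖A (b i)‖ : ℂ) ≠ 0 := by simpa using h
    rw [dirVec, map_smul, smul_inv_smul₀ this]

theorem norm_dirVec_le (i : ι) : ‖dirVec A b i‖ ≤ 1 := by
  rw [dirVec, map_smul, norm_smul, norm_inv, Complex.norm_real, norm_norm]
  exact inv_mul_le_one

theorem norm_dirVec_eq {i : ι} (h : A (b i) ≠ 0) : ‖dirVec A b i‖ = 1 := by
  rw [dirVec, map_smul, norm_smul, norm_inv, Complex.norm_real, norm_norm,
    inv_mul_cancel₀ (norm_ne_zero_iff.2 h)]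

end

variable [CompleteSpace H]

/-! ### Functional calculus on eigenvectors -/

/-- The real continuous functional calculus acts on eigenvectors by evaluation. -/
theorem cfc_apply_of_apply_eq_smul {a : H →L[ℂ] H} (ha : IsSelfAdjoint a) {f : ℝ → ℝ}
    (hf : Continuous f) {t : ℝ} {v : H} (hv : a v = t • v) : cfc f a v = f t • v := by
  rcases eq_or_ne v 0 with rfl | hv0
  · simp
  have ht : t ∈ spectrum ℝ a := by
    intro h
    obtain ⟨u, hu⟩ := h
    have h1 : (u : H →L[ℂ] H) v = 0 := by
      rw [hu, sub_apply, hv, Algebra.algebraMap_eq_smul_one]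
      simp
    apply hv0
    have h2 : ((↑u⁻¹ : H →L[ℂ] H) * u) v = 0 := by
      rw [mul_apply_eq_comp, h1, map_zero]
    simpa using h2
  have key : ∀ g : C(spectrum ℝ a, ℝ), cfcHom ha g v = g ⟨t, ht⟩ • v := by
    intro g
    induction g using ContinuousMap.induction_on_of_compact with
    | const r =>
      have : (ContinuousMap.const (spectrum ℝ a) r) = algebraMap ℝ C(spectrum ℝ a, ℝ) r := rfl
      rw [this, AlgHomClass.commutes, Algebra.algebraMap_eq_smul_one]
      simp
    | id =>
      have := cfcHom_id (R := ℝ) ha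
      rw [this, hv]
      rfl
    | star_id =>
      have := cfcHom_id (R := ℝ) ha
      rw [map_star, this, ha.star_eq, hv]
      rfl
    | add f g hf hg => rw [map_add, add_apply, hf, hg, ← add_smul]; rfl
    | mul f g hf hg =>
      rw [map_mul, mul_apply_eq_comp, hg, ContinuousLinearMap.map_smul_of_tower, hf, smul_smul,
        mul_comm]
      rfl
    | frequently g h =>
      have hc : IsClosed {g : C(spectrum ℝ a, ℝ) | cfcHom ha g v = g ⟨t, ht⟩ • v} := by
        refine isClosed_eq ?_ ?_
        · exact (ContinuousLinearMap.apply ℂ H v).continuous.comp (cfcHom_continuous ha)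
        · fun_prop
      exact hc.closure_subset (mem_closure_iff_frequently.2 h)
  rw [cfc_apply f a ha hf.continuousOn, key]
  rfl

theorem rpow_apply_of_apply_eq_smul {a : H →L[ℂ] H} (ha : 0 ≤ a) {t : ℝ} (ht : 0 ≤ t) {y : ℝ}
    (hy : 0 < y) {v : H} (hv : a v = t • v) : (a ^ y) v = t ^ y • v := by
  have h : a ^ y = cfc (fun x : ℝ => |x| ^ y) a := by
    rw [CFC.rpow_eq_cfc_real (ha := ha)]
    refine cfc_congr fun x hx => ?_
    rw [abs_of_nonneg (spectrum_nonneg_of_nonneg ha hx)]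
  rw [h, cfc_apply_of_apply_eq_smul ha.isSelfAdjoint ?_ hv, abs_of_nonneg ht]
  exact continuous_abs.rpow_const fun x => Or.inr hy.le

/-! ### Singular bases of compact operators -/

/-- A Hilbert basis of eigenvectors of `A* A`. -/
def IsSingularBasis {ι : Type*} (A : H →L[ℂ] H) (b : HilbertBasis ι ℂ H) : Prop :=
  ∀ i, star A (A (b i)) = (‖A (b i)‖ ^ 2) • b i

/-- Such a basis diagonalises `|A|` with eigenvalues `‖A (b i)‖`; this reduces all traces below to
sums of powers of singular values. -/
theorem IsSingularBasis.posTrace_abs_rpow {ι : Type*} {A : H →L[ℂ] H} {b : HilbertBasis ι ℂ H}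
    (hb : IsSingularBasis A b) {p : ℝ} (hp : 0 < p) :
    posTrace (CFC.abs A ^ p) = ∑' i, ‖A (b i)‖ₑ ^ p := by
  rw [posTrace_eq_diagSum b CFC.rpow_nonneg]
  refine tsum_congr fun i => ?_
  have h1 : CFC.abs A (b i) = ‖A (b i)‖ • b i := by
    rw [CFC.abs, CFC.sqrt_eq_rpow, rpow_apply_of_apply_eq_smul (star_mul_self_nonneg A)
      (sq_nonneg ‖A (b i)‖) (by norm_num) (hb i), ← Real.sqrt_eq_rpow,
      Real.sqrt_sq (norm_nonneg _)]
  rw [rpow_apply_of_apply_eq_smul (CFC.abs_nonneg A) (norm_nonneg _) hp h1]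
  rw [← Complex.coe_smul, inner_smul_left, inner_self_eq_norm_sq_to_K, b.orthonormal.1 i]
  simp only [Complex.conj_ofReal, RCLike.ofReal_one, one_pow, mul_one]
  rw [← ofReal_norm, ENNReal.ofReal_rpow_of_nonneg (norm_nonneg _) hp.le]
  rfl

/-- An orthogonal family of complete subspaces with dense span admits an adapted Hilbert basis. -/
theorem OrthogonalFamily.exists_hilbertBasis_mem.{u, v} {H : Type u} [NormedAddCommGroup H]
    [InnerProductSpace ℂ H] [CompleteSpace H] {κ : Type v} {E : κ → Submodule ℂ H}
    (hE : OrthogonalFamily ℂ (fun k => E k) fun k => (E k).subtypeₗᵢ)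
    (hc : ∀ k, CompleteSpace (E k)) (hbot : (⨆ k, E k)ᗮ = ⊥) :
    ∃ (ι : Type (max u v)) (b : HilbertBasis ι ℂ H), ∀ i, ∃ k, b i ∈ E k := by
  choose w c _ using fun k => exists_hilbertBasis ℂ (E k)
  let v : (Σ k, w k) → H := fun x => ((c x.1 x.2 : E x.1) : H)
  have hon : Orthonormal ℂ v := hE.orthonormal_sigma_orthonormal fun k => (c k).orthonormal
  have hbot' : (Submodule.span ℂ (Set.range v))ᗮ = ⊥ := by
    rw [eq_bot_iff, ← hbot]
    intro x hx
    rw [← Submodule.iInf_orthogonal, Submodule.mem_iInf]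
    intro k
    rw [← Submodule.orthogonalProjectionOnto_eq_zero_iff]
    apply (c k).repr.injective
    ext i
    rw [map_zero, HilbertBasis.repr_apply_apply,
      Submodule.inner_orthogonalProjectionOnto_eq_of_mem_left]
    have hi : v ⟨k, i⟩ ∈ Submodule.span ℂ (Set.range v) := Submodule.subset_span ⟨_, rfl⟩
    exact Submodule.inner_right_of_mem_orthogonal hi hx
  have hmem : ∀ i, v i ∈ E i.1 := fun i => (c i.1 i.2).2
  have hb : ∀ i, HilbertBasis.mkOfOrthogonalEqBot hon hbot' i = v i := fun i => by
    rw [HilbertBasis.coe_mkOfOrthogonalEqBot]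
  exact ⟨Σ k, w k, HilbertBasis.mkOfOrthogonalEqBot hon hbot', fun i =>
    ⟨i.1, (hb i).symm ▸ hmem i⟩⟩

theorem exists_isSingularBasis.{u} {H : Type u} [NormedAddCommGroup H] [InnerProductSpace ℂ H]
    [CompleteSpace H] {A : H →L[ℂ] H} (hA : IsCompactOperator A) :
    ∃ (ι : Type u) (b : HilbertBasis ι ℂ H), IsSingularBasis A b := by
  have hTc : IsCompactOperator (star A * A) := hA.clm_comp (star A)
  have hTs : ((star A * A : H →L[ℂ] H) : H →ₗ[ℂ] H).IsSymmetric :=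
    (IsSelfAdjoint.star_mul_self A).isSymmetric
  obtain ⟨ι, b, hb⟩ := hTs.orthogonalFamily_eigenspaces.exists_hilbertBasis_mem (fun μ => by
      have h : IsClosed {x | (star A * A) x = μ • x} :=
        isClosed_eq (star A * A).continuous (continuous_const_smul μ)
      have h2 : IsClosed (Module.End.eigenspace
          ((star A * A : H →L[ℂ] H) : Module.End ℂ H) μ : Set H) := by
        convert h using 1
        ext x
        exact Module.End.mem_eigenspace_iff
      exact h2.completeSpace_coe)
    (ContinuousLinearMap.orthogonalComplement_iSup_eigenspaces_eq_bot hTc hTs)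
  refine ⟨ι, b, fun i => ?_⟩
  obtain ⟨μ, hμ⟩ := hb i
  have hv : star A (A (b i)) = μ • b i := Module.End.mem_eigenspace_iff.1 hμ
  -- Pairing with the unit vector `b i` identifies the eigenvalue `μ`.
  have h1 : (⟪b i, star A (A (b i))⟫_ℂ) = (‖A (b i)‖ : ℂ) ^ 2 := by
    rw [ContinuousLinearMap.star_eq_adjoint, ContinuousLinearMap.adjoint_inner_right,
      inner_self_eq_norm_sq_to_K]
    rfl
  rw [hv, inner_smul_right, inner_self_eq_norm_sq_to_K, b.orthonormal.1 i] at h1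
  simp only [RCLike.ofReal_one, one_pow, mul_one] at h1
  rw [hv, h1, ← Complex.coe_smul]
  push_cast
  rfl

/-! ### Comparing the singular values of `A` and `A + B` -/

section
variable {ι κ : Type*} {A B C : H →L[ℂ] H} {b : HilbertBasis ι ℂ H} {c : HilbertBasis κ ℂ H}

namespace IsSingularBasis

theorem star_apply_dirVec (hb : IsSingularBasis A b) (i : ι) :
    star A (dirVec A b i) = (‖A (b i)‖ : ℂ) • b i := by
  rw [dirVec, map_smul, map_smul, hb i, ← Complex.coe_smul, smul_smul]
  congr 1
  rcases eq_or_ne (‖A (b i)‖ : ℂ) 0 with h | h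
  · simp [h]
  · push_cast
    field_simp

/-- Expand `⟪A* A y, y⟫` along the eigenbasis `b`. -/
theorem tsum_enorm_sq (hb : IsSingularBasis A b) (y : H) :
    ∑' i, ‖⟪b i, y⟫_ℂ‖ₑ ^ 2 * ‖A (b i)‖ₑ ^ 2 = ‖A y‖ₑ ^ 2 := by
  have h := (b.hasSum_inner_mul_inner (star A (A y)) y).mapL Complex.reCLM
  have h2 : HasSum (fun i => ‖⟪b i, y⟫_ℂ‖ ^ 2 * ‖A (b i)‖ ^ 2) (‖A y‖ ^ 2) := by
    convert h using 1
    · funext i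
      have : ⟪star A (A y), b i⟫_ℂ = (‖A (b i)‖ ^ 2 : ℝ) * ⟪y, b i⟫_ℂ := by
        rw [ContinuousLinearMap.star_eq_adjoint, ContinuousLinearMap.adjoint_inner_left,
          ← ContinuousLinearMap.adjoint_inner_right, ← ContinuousLinearMap.star_eq_adjoint, hb i,
          ← Complex.coe_smul, inner_smul_right]
      rw [this, mul_assoc, ← inner_conj_symm y (b i), RCLike.conj_mul,
        Complex.reCLM_apply, Complex.re_ofReal_mul, mul_comm]
      norm_cast
    · rw [ContinuousLinearMap.star_eq_adjoint, ContinuousLinearMap.adjoint_inner_left,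
        inner_self_eq_norm_sq_to_K]
      norm_cast
  have h3 := ENNReal.ofReal_tsum_of_nonneg (fun i => by positivity) h2.summable
  rw [h2.tsum_eq] at h3
  simp only [← ofReal_norm, ← ENNReal.ofReal_pow (norm_nonneg _),
    ← ENNReal.ofReal_mul (sq_nonneg _)]
  exact h3.symm

/-- Moving `A` across the inner product turns the `i`-th coefficient into `‖A (b i)‖ ⟪b i, y⟫`: on
`ran A`, Bessel's inequality for the left singular vectors is an equality. -/
theorem tsum_enorm_inner_dirVec_sq (hb : IsSingularBasis A b) (y : H) :
    ∑' i, ‖⟪dirVec A b i, A y⟫_ℂ‖ₑ ^ 2 = ‖A y‖ₑ ^ 2 := by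
  rw [← hb.tsum_enorm_sq y]
  refine tsum_congr fun i => ?_
  rw [← ContinuousLinearMap.adjoint_inner_left, ← ContinuousLinearMap.star_eq_adjoint,
    hb.star_apply_dirVec, inner_smul_left, enorm_mul, RCLike.enorm_conj, mul_pow, mul_comm]
  congr 2
  rw [← ofReal_norm, Complex.norm_real, norm_norm, ofReal_norm]

theorem inner_apply_apply (hb : IsSingularBasis A b) {i j : ι} (hij : i ≠ j) :
    ⟪A (b i), A (b j)⟫_ℂ = 0 := by
  rw [← ContinuousLinearMap.adjoint_inner_right, ← ContinuousLinearMap.star_eq_adjoint, hb j,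
    ← Complex.coe_smul, inner_smul_right, b.orthonormal.2 hij, mul_zero]

/-- Bessel's inequality: the nonzero `dirVec A b i` are orthonormal. -/
theorem tsum_enorm_inner_dirVec_sq_le (hb : IsSingularBasis A b) (x : H) :
    ∑' i, ‖⟪dirVec A b i, x⟫_ℂ‖ₑ ^ 2 ≤ ‖x‖ₑ ^ 2 := by
  have hs : Function.support (fun i => ‖⟪dirVec A b i, x⟫_ℂ‖ₑ ^ 2) ⊆ {i | A (b i) ≠ 0} := by
    intro i hi h0
    apply hi
    simp [dirVec, h0]
  rw [← tsum_subtype_eq_of_support_subset hs]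
  have hon : Orthonormal ℂ (fun i : {i | A (b i) ≠ 0} => dirVec A b i) := by
    refine ⟨fun i => norm_dirVec_eq i.2, fun i j hij => ?_⟩
    simp only [dirVec, map_smul, inner_smul_left, inner_smul_right]
    rw [hb.inner_apply_apply (fun h => hij (Subtype.ext h)), mul_zero, mul_zero]
  rw [ENNReal.tsum_eq_iSup_sum]
  refine iSup_le fun s => ?_
  simp only [← ofReal_norm, ← ENNReal.ofReal_pow (norm_nonneg _)]
  rw [← ENNReal.ofReal_sum_of_nonneg fun i _ => sq_nonneg _]
  exact ENNReal.ofReal_le_ofReal (hon.sum_inner_products_le x)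

/-- If `C* = A*` on `ran A`, then the squared singular values of `A` are averages of those
of `C`. -/
theorem enorm_sq_eq_tsum (hb : IsSingularBasis A b) (h : ∀ x, star C (A x) = star A (A x)) (i : ι) :
    ‖A (b i)‖ₑ ^ 2 = ∑' k, ‖⟪dirVec C c k, dirVec A b i⟫_ℂ‖ₑ ^ 2 * ‖C (c k)‖ₑ ^ 2 := by
  -- The agreement of `C*` and `A*` on `ran A` enters here; Parseval along `c` then gives the
  -- average.
  have h1 : ‖A (b i)‖ₑ = ‖star C (dirVec A b i)‖ₑ := by
    have h2 : star C (dirVec A b i) = (‖A (b i)‖ : ℂ) • b i :=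
      (h _).trans (hb.star_apply_dirVec i)
    rw [h2, ← ofReal_norm, ← ofReal_norm, norm_smul, Complex.norm_real, norm_norm,
      b.orthonormal.1 i, mul_one]
  rw [h1, ← c.tsum_enorm_inner_sq]
  refine tsum_congr fun k => ?_
  rw [ContinuousLinearMap.star_eq_adjoint, ContinuousLinearMap.adjoint_inner_right,
    ← mul_pow]
  congr 1
  conv_lhs => rw [← norm_smul_dirVec (A := C) k, inner_smul_left, enorm_mul, RCLike.enorm_conj]
  rw [mul_comm]
  congr 1
  rw [← ofReal_norm, Complex.norm_real, norm_norm, ofReal_norm]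

theorem tsum_enorm_inner_dirVec_dirVec_le (hc : IsSingularBasis C c) (i : ι) :
    ∑' k, ‖⟪dirVec C c k, dirVec A b i⟫_ℂ‖ₑ ^ 2 ≤ 1 := by
  refine (hc.tsum_enorm_inner_dirVec_sq_le _).trans ?_
  refine pow_le_one₀ zero_le ?_
  rw [← ofReal_norm]
  exact ENNReal.ofReal_le_one.2 (norm_dirVec_le i)

/-- Jensen in each row `i`, then exchange of the two sums. -/
theorem tsum_rpow_le_of_two_le (hb : IsSingularBasis A b) (hc : IsSingularBasis C c)
    (h : ∀ x, star C (A x) = star A (A x)) {p : ℝ} (hp : 2 ≤ p) :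
    ∑' i, ‖A (b i)‖ₑ ^ p ≤
      ∑' k, (∑' i, ‖⟪dirVec C c k, dirVec A b i⟫_ℂ‖ₑ ^ 2) * ‖C (c k)‖ₑ ^ p := by
  simp only [← ENNReal.tsum_mul_right]
  rw [ENNReal.tsum_comm]
  refine ENNReal.tsum_le_tsum fun i => ?_
  have := ENNReal.rpow_tsum_mul_le (hc.tsum_enorm_inner_dirVec_dirVec_le (A := A) (b := b) i)
    (fun k => ‖C (c k)‖ₑ ^ 2) (q := p / 2) (by linarith)
  simpa only [← hb.enorm_sq_eq_tsum h i, ENNReal.sq_rpow_half] using this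

theorem le_tsum_rpow_of_le_two (hb : IsSingularBasis A b) (hc : IsSingularBasis C c)
    (h : ∀ x, star C (A x) = star A (A x)) {p : ℝ} (hp0 : 0 < p) (hp : p ≤ 2) :
    ∑' k, (∑' i, ‖⟪dirVec C c k, dirVec A b i⟫_ℂ‖ₑ ^ 2) * ‖C (c k)‖ₑ ^ p ≤
      ∑' i, ‖A (b i)‖ₑ ^ p := by
  simp only [← ENNReal.tsum_mul_right]
  rw [ENNReal.tsum_comm]
  refine ENNReal.tsum_le_tsum fun i => ?_
  have := ENNReal.tsum_mul_rpow_le (hc.tsum_enorm_inner_dirVec_dirVec_le (A := A) (b := b) i)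
    (fun k => ‖C (c k)‖ₑ ^ 2) (q := p / 2) (by linarith) (by linarith)
  simpa only [← hb.enorm_sq_eq_tsum h i, ENNReal.sq_rpow_half] using this

end IsSingularBasis

/-- Pythagoras for the splitting of a vector of `ran (A + B)` into its components in `ran A` and
`ran B`, then Parseval in each range. -/
theorem tsum_enorm_inner_dirVec_add {μ : Type*} {d : HilbertBasis μ ℂ H}
    (hb : IsSingularBasis A b) (hc : IsSingularBasis B c)
    (h : ∀ x y, ⟪A x, B y⟫_ℂ = 0) (k : μ) :
    ∑' i, ‖⟪dirVec (A + B) d k, dirVec A b i⟫_ℂ‖ₑ ^ 2 +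
      ∑' j, ‖⟪dirVec (A + B) d k, dirVec B c j⟫_ℂ‖ₑ ^ 2 = ‖dirVec (A + B) d k‖ₑ ^ 2 := by
  -- The normalising scalar in `dirVec` sits inside the operator, so the vector visibly lies in the
  -- range.
  obtain ⟨y, hy⟩ : ∃ y, dirVec (A + B) d k = A y + B y := ⟨_, add_apply _ _ _⟩
  have h' : ∀ x y, ⟪B x, A y⟫_ℂ = 0 := fun x y => inner_eq_zero_symm.1 (h y x)
  rw [hy, enorm_add_sq_of_inner_eq_zero (h y y), ← hb.tsum_enorm_inner_dirVec_sq y,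
    ← hc.tsum_enorm_inner_dirVec_sq y]
  congr 1 <;> refine tsum_congr fun i => ?_ <;> congr 1 <;> rw [enorm_inner_comm] <;>
    rw [inner_add_right]
  · rw [show ⟪dirVec A b i, B y⟫_ℂ = 0 from h _ _, add_zero]
  · rw [show ⟪dirVec B c i, A y⟫_ℂ = 0 from h' _ _, zero_add]

theorem star_apply_apply_eq_zero (h : ∀ x y, ⟪A x, B y⟫_ℂ = 0) (y : H) : star A (B y) = 0 := by
  rw [← inner_self_eq_zero (𝕜 := ℂ)]
  nth_rw 2 [ContinuousLinearMap.star_eq_adjoint]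
  rw [ContinuousLinearMap.adjoint_inner_right]
  exact h _ _

theorem star_add_apply_left (h : ∀ x y, ⟪A x, B y⟫_ℂ = 0) (x : H) :
    star (A + B) (A x) = star A (A x) := by
  rw [star_add, add_apply, star_apply_apply_eq_zero fun x y => inner_eq_zero_symm.1 (h y x),
    add_zero]

theorem star_add_apply_right (h : ∀ x y, ⟪A x, B y⟫_ℂ = 0) (x : H) :
    star (A + B) (B x) = star B (B x) := by
  rw [star_add, add_apply, star_apply_apply_eq_zero h, zero_add]

end

/-! ### Trace inequalities for sums -/

section
variable {A B : H →L[ℂ] H} {p : ℝ}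

/-- Superadditivity of `tr |A| ^ p` for orthogonal ranges, `2 ≤ p`. -/
theorem posTrace_add_le_of_two_le (hA : IsCompactOperator A) (hB : IsCompactOperator B)
    (h : ∀ x y, ⟪A x, B y⟫_ℂ = 0) (hp : 2 ≤ p) :
    posTrace (CFC.abs A ^ p) + posTrace (CFC.abs B ^ p) ≤ posTrace (CFC.abs (A + B) ^ p) := by
  obtain ⟨ι, b, hb⟩ := exists_isSingularBasis hA
  obtain ⟨κ, c, hc⟩ := exists_isSingularBasis hB
  obtain ⟨μ, d, hd⟩ := exists_isSingularBasis (A := A + B) (hA.add hB)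
  have hp0 : 0 < p := by linarith
  rw [hb.posTrace_abs_rpow hp0, hc.posTrace_abs_rpow hp0, hd.posTrace_abs_rpow hp0]
  refine (add_le_add (hb.tsum_rpow_le_of_two_le hd (star_add_apply_left h) hp)
    (hc.tsum_rpow_le_of_two_le hd (star_add_apply_right h) hp)).trans ?_
  rw [← ENNReal.tsum_add]
  refine ENNReal.tsum_le_tsum fun k => ?_
  rw [← add_mul, tsum_enorm_inner_dirVec_add hb hc h]
  refine mul_le_of_le_one_left zero_le (pow_le_one₀ zero_le ?_)
  rw [← ofReal_norm]
  exact ENNReal.ofReal_le_one.2 (norm_dirVec_le k)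

/-- Subadditivity of `tr |A| ^ p` for orthogonal ranges, `p ≤ 2`. -/
theorem posTrace_add_le_of_le_two (hA : IsCompactOperator A) (hB : IsCompactOperator B)
    (h : ∀ x y, ⟪A x, B y⟫_ℂ = 0) (hp0 : 0 < p) (hp : p ≤ 2) :
    posTrace (CFC.abs (A + B) ^ p) ≤ posTrace (CFC.abs A ^ p) + posTrace (CFC.abs B ^ p) := by
  obtain ⟨ι, b, hb⟩ := exists_isSingularBasis hA
  obtain ⟨κ, c, hc⟩ := exists_isSingularBasis hB
  obtain ⟨μ, d, hd⟩ := exists_isSingularBasis (A := A + B) (hA.add hB)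
  rw [hb.posTrace_abs_rpow hp0, hc.posTrace_abs_rpow hp0, hd.posTrace_abs_rpow hp0]
  refine le_trans ?_ (add_le_add (hb.le_tsum_rpow_of_le_two hd (star_add_apply_left h) hp0 hp)
    (hc.le_tsum_rpow_of_le_two hd (star_add_apply_right h) hp0 hp))
  rw [← ENNReal.tsum_add]
  refine ENNReal.tsum_le_tsum fun k => ?_
  rw [← add_mul, tsum_enorm_inner_dirVec_add hb hc h]
  -- Here the total weight must be exactly 1; it can fail to be only where the singular value
  -- vanishes, and there the term is 0.
  rcases eq_or_ne ((A + B) (d k)) 0 with h0 | h0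
  · rw [h0, enorm_zero, ENNReal.zero_rpow_of_pos hp0]
    exact zero_le
  · rw [← ofReal_norm (dirVec _ _ _), norm_dirVec_eq h0]
    simp

/-- Jensen with the doubly stochastic weights `|⟪b i, c k⟫|²`. It allows `A`, `B` and `A + B` to be
compared along one basis. -/
theorem IsSingularBasis.tsum_enorm_rpow_le {ι κ : Type*} {b : HilbertBasis ι ℂ H}
    (hb : IsSingularBasis A b) (c : HilbertBasis κ ℂ H) (hp : 2 ≤ p) :
    ∑' k, ‖A (c k)‖ₑ ^ p ≤ ∑' i, ‖A (b i)‖ₑ ^ p := by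
  have h1 : ∀ k, ‖A (c k)‖ₑ ^ p ≤ ∑' i, ‖⟪b i, c k⟫_ℂ‖ₑ ^ 2 * ‖A (b i)‖ₑ ^ p := by
    intro k
    have hw : ∑' i, ‖⟪b i, c k⟫_ℂ‖ₑ ^ 2 ≤ 1 := by
      rw [b.tsum_enorm_inner_sq, ← ofReal_norm, c.orthonormal.1 k]
      simp
    have := ENNReal.rpow_tsum_mul_le hw (fun i => ‖A (b i)‖ₑ ^ 2) (q := p / 2) (by linarith)
    simpa only [hb.tsum_enorm_sq, ENNReal.sq_rpow_half] using this
  refine (ENNReal.tsum_le_tsum h1).trans ?_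
  rw [ENNReal.tsum_comm]
  refine ENNReal.tsum_le_tsum fun i => ?_
  simp only [enorm_inner_comm (b i)]
  rw [ENNReal.tsum_mul_right, c.tsum_enorm_inner_sq, ← ofReal_norm, b.orthonormal.1 i]
  simp

/-- For `2 ≤ p` superadditivity bounds `tr |A + B|^p` only from below, so finiteness needs this
separate argument. -/
theorem posTrace_add_lt_top_of_two_le (hA : IsCompactOperator A) (hB : IsCompactOperator B)
    (hp : 2 ≤ p) (hA' : posTrace (CFC.abs A ^ p) < ∞) (hB' : posTrace (CFC.abs B ^ p) < ∞) :
    posTrace (CFC.abs (A + B) ^ p) < ∞ := by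
  obtain ⟨ι, b, hb⟩ := exists_isSingularBasis hA
  obtain ⟨κ, c, hc⟩ := exists_isSingularBasis hB
  obtain ⟨μ, d, hd⟩ := exists_isSingularBasis (A := A + B) (hA.add hB)
  have hp0 : 0 < p := by linarith
  rw [hb.posTrace_abs_rpow hp0] at hA'
  rw [hc.posTrace_abs_rpow hp0] at hB'
  rw [hd.posTrace_abs_rpow hp0]
  calc ∑' k, ‖(A + B) (d k)‖ₑ ^ p
      ≤ ∑' k, 2 ^ (p - 1) * (‖A (d k)‖ₑ ^ p + ‖B (d k)‖ₑ ^ p) := by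
        refine ENNReal.tsum_le_tsum fun k => ?_
        refine le_trans ?_ (ENNReal.rpow_add_le_mul_rpow_add_rpow _ _ (by linarith))
        exact ENNReal.rpow_le_rpow (enorm_add_le _ _) hp0.le
    _ = 2 ^ (p - 1) * (∑' k, ‖A (d k)‖ₑ ^ p + ∑' k, ‖B (d k)‖ₑ ^ p) := by
        rw [ENNReal.tsum_mul_left, ENNReal.tsum_add]
    _ < ∞ := by
        refine ENNReal.mul_lt_top (by finiteness) (ENNReal.add_lt_top.2 ⟨?_, ?_⟩)
        · exact (hb.tsum_enorm_rpow_le d hp).trans_lt hA'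
        · exact (hc.tsum_enorm_rpow_le d hp).trans_lt hB'
end

/-! ### Schatten classes and the inequality for a pair -/

section
variable {A B : H →L[ℂ] H} {p : ℝ}

theorem mem_schattenClass_iff (hp : 0 < p) :
    A ∈ schattenClass H p ↔ IsCompactOperator A ∧ posTrace (CFC.abs A ^ p) < ∞ := by
  have h : schattenENorm p A < ∞ ↔ posTrace (CFC.abs A ^ p) < ∞ := by
    rw [schattenENorm, ENNReal.rpow_lt_top_iff_of_pos (by positivity)]
  exact and_congr_right fun _ => h

theorem schattenNorm_sq : schattenNorm p A ^ 2 = (posTrace (CFC.abs A ^ p)).toReal ^ (2 / p) := by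
  rw [schattenNorm, schattenENorm, ← ENNReal.toReal_rpow, ← Real.rpow_natCast,
    ← Real.rpow_mul ENNReal.toReal_nonneg]
  congr 1
  push_cast
  ring

theorem schattenENorm_neg : schattenENorm p (-A) = schattenENorm p A := by
  rw [schattenENorm, schattenENorm, CFC.abs, CFC.abs, star_neg, neg_mul_neg]

theorem neg_mem_schattenClass (hA : A ∈ schattenClass H p) : -A ∈ schattenClass H p :=
  ⟨hA.1.neg, schattenENorm_neg.trans_lt hA.2⟩

theorem zero_mem_schattenClass (hp : 0 < p) : (0 : H →L[ℂ] H) ∈ schattenClass H p := by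
  have h0 : IsCompactOperator (0 : H →L[ℂ] H) := isCompactOperator_zero
  obtain ⟨ι, b, hb⟩ := exists_isSingularBasis h0
  refine (mem_schattenClass_iff hp).2 ⟨h0, ?_⟩
  rw [hb.posTrace_abs_rpow hp]
  simp [hp]

theorem schattenNorm_zero (hp : 0 < p) : schattenNorm p (0 : H →L[ℂ] H) = 0 := by
  have h0 : IsCompactOperator (0 : H →L[ℂ] H) := isCompactOperator_zero
  obtain ⟨ι, b, hb⟩ := exists_isSingularBasis h0
  rw [schattenNorm, schattenENorm, hb.posTrace_abs_rpow hp]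
  simp [hp]

theorem schattenENorm_add_self (hp : 0 < p) (hA : IsCompactOperator A) :
    schattenENorm p (A + A) = 2 * schattenENorm p A := by
  obtain ⟨ι, b, hb⟩ := exists_isSingularBasis hA
  have hn : ∀ x, ‖(A + A) x‖ = 2 * ‖A x‖ := fun x => by
    rw [add_apply, ← two_smul ℝ, norm_smul, Real.norm_ofNat]
  have hb' : IsSingularBasis (A + A) b := fun i => by
    rw [hn, star_add, add_apply, add_apply, map_add, hb i, ← add_smul, ← add_smul]
    congr 1
    ring
  have he : ∀ x, ‖(A + A) x‖ₑ = 2 * ‖A x‖ₑ := fun x => by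
    rw [← ofReal_norm, hn, ENNReal.ofReal_mul zero_le_two, ofReal_norm, ENNReal.ofReal_ofNat]
  rw [schattenENorm, schattenENorm, hb.posTrace_abs_rpow hp, hb'.posTrace_abs_rpow hp]
  simp only [he, ENNReal.mul_rpow_of_nonneg _ _ hp.le]
  rw [ENNReal.tsum_mul_left, ENNReal.mul_rpow_of_nonneg _ _ (by positivity), ← ENNReal.rpow_mul,
    mul_one_div_cancel hp.ne', ENNReal.rpow_one]

theorem schattenNorm_add_self (hp : 0 < p) (hA : IsCompactOperator A) :
    schattenNorm p (A + A) = 2 * schattenNorm p A := by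
  rw [schattenNorm, schattenENorm_add_self hp hA, ENNReal.toReal_mul]
  rfl

theorem add_self_mem_schattenClass (hp : 0 < p) (hA : A ∈ schattenClass H p) :
    A + A ∈ schattenClass H p :=
  ⟨hA.1.add hA.1, by
    rw [schattenENorm_add_self hp hA.1]
    exact ENNReal.mul_lt_top (by finiteness) hA.2⟩

theorem add_mem_schattenClass_of_inner_eq_zero (hp : 0 < p) (hA : A ∈ schattenClass H p)
    (hB : B ∈ schattenClass H p) (h : ∀ x y, ⟪A x, B y⟫_ℂ = 0) : A + B ∈ schattenClass H p := by
  rw [mem_schattenClass_iff hp] at hA hB ⊢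
  refine ⟨hA.1.add hB.1, ?_⟩
  rcases le_total p 2 with h2 | h2
  · exact (posTrace_add_le_of_le_two hA.1 hB.1 h hp h2).trans_lt (ENNReal.add_lt_top.2 ⟨hA.2, hB.2⟩)
  · exact posTrace_add_lt_top_of_two_le hA.1 hB.1 h2 hA.2 hB.2

theorem schattenNorm_add_sq_le (hp : 0 < p) (hp2 : p ≤ 2) (hA : A ∈ schattenClass H p)
    (hB : B ∈ schattenClass H p) (h : ∀ x y, ⟪A x, B y⟫_ℂ = 0) :
    schattenNorm p (A + B) ^ 2 ≤
      2 ^ (2 / p - 1) * (schattenNorm p A ^ 2 + schattenNorm p B ^ 2) := by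
  rw [mem_schattenClass_iff hp] at hA hB
  simp only [schattenNorm_sq]
  have h1 := ENNReal.toReal_mono (ENNReal.add_lt_top.2 ⟨hA.2, hB.2⟩).ne
    (posTrace_add_le_of_le_two hA.1 hB.1 h hp hp2)
  rw [ENNReal.toReal_add hA.2.ne hB.2.ne] at h1
  refine (Real.rpow_le_rpow ENNReal.toReal_nonneg h1 (by positivity)).trans ?_
  have hq : 1 ≤ 2 / p := by rwa [one_le_div hp]
  exact_mod_cast NNReal.rpow_add_le_mul_rpow_add_rpow (posTrace (CFC.abs A ^ p)).toNNReal
    (posTrace (CFC.abs B ^ p)).toNNReal hq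

theorem le_schattenNorm_add_sq (hp2 : 2 ≤ p) (hA : A ∈ schattenClass H p)
    (hB : B ∈ schattenClass H p) (h : ∀ x y, ⟪A x, B y⟫_ℂ = 0) :
    2 ^ (2 / p - 1) * (schattenNorm p A ^ 2 + schattenNorm p B ^ 2) ≤
      schattenNorm p (A + B) ^ 2 := by
  have hp : 0 < p := by linarith
  have hAB := add_mem_schattenClass_of_inner_eq_zero hp hA hB h
  rw [mem_schattenClass_iff hp] at hA hB hAB
  simp only [schattenNorm_sq]
  have h1 := ENNReal.toReal_mono hAB.2.ne (posTrace_add_le_of_two_le hA.1 hB.1 h hp2)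
  rw [ENNReal.toReal_add hA.2.ne hB.2.ne] at h1
  refine le_trans ?_ (Real.rpow_le_rpow (by positivity) h1 (by positivity))
  set u := (posTrace (CFC.abs A ^ p)).toNNReal
  set v := (posTrace (CFC.abs B ^ p)).toNNReal
  change (2 : ℝ) ^ (2 / p - 1) * ((u : ℝ) ^ (2 / p) + (v : ℝ) ^ (2 / p)) ≤
    ((u : ℝ) + v) ^ (2 / p)
  -- Convexity of `t ^ (p / 2)` is applied at `u ^ (2 / p)` and `v ^ (2 / p)`; raising to the power
  -- `2 / p` inverts the constant `2 ^ (2 / p - 1)`.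
  have hq : 1 ≤ p / 2 := by linarith
  have h2 := NNReal.rpow_add_le_mul_rpow_add_rpow (u ^ (2 / p)) (v ^ (2 / p)) hq
  rw [← NNReal.rpow_mul, ← NNReal.rpow_mul, div_mul_div_cancel₀ hp.ne', div_self two_ne_zero,
    NNReal.rpow_one, NNReal.rpow_one] at h2
  have h3 := NNReal.rpow_le_rpow h2 (by positivity : 0 ≤ 2 / p)
  rw [NNReal.mul_rpow, ← NNReal.rpow_mul, ← NNReal.rpow_mul,
    show p / 2 * (2 / p) = 1 by field_simp, show (p / 2 - 1) * (2 / p) = -(2 / p - 1) by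
      field_simp; ring, NNReal.rpow_one, NNReal.rpow_neg] at h3
  have h4 := (le_inv_mul_iff₀ (NNReal.rpow_pos two_pos)).1 h3
  exact_mod_cast h4
end

/-! ### Summation over pairs and the main theorem -/

/-- Using the pair bound everywhere gives `2 * c * n`; correcting the diagonal adds `d - 2 * c`. -/
theorem sum_sum_le_of_pair_le {n : ℕ} {f : Fin n → Fin n → ℝ} {x : Fin n → ℝ} {c d : ℝ}
    (hne : ∀ i j, i ≠ j → f i j ≤ c * (x i + x j)) (hd : ∀ i, f i i ≤ d * x i) :
    ∑ i, ∑ j, f i j ≤ (2 * c * (n - 1) + d) * ∑ i, x i := by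
  have h : ∀ i j, f i j ≤ c * (x i + x j) + if i = j then (d - 2 * c) * x i else 0 := by
    intro i j
    split_ifs with hij
    · subst hij
      linarith [hd i]
    · linarith [hne i j hij]
  refine (Finset.sum_le_sum fun i _ => Finset.sum_le_sum fun j _ => h i j).trans_eq ?_
  simp only [Finset.sum_add_distrib, ← Finset.mul_sum, Finset.sum_ite_eq, Finset.mem_univ,
    if_true, Finset.sum_const, Finset.card_univ, Fintype.card_fin, nsmul_eq_mul]
  ring

theorem le_sum_sum_of_le_pair {n : ℕ} {f : Fin n → Fin n → ℝ} {x : Fin n → ℝ} {c d : ℝ}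
    (hne : ∀ i j, i ≠ j → c * (x i + x j) ≤ f i j) (hd : ∀ i, d * x i ≤ f i i) :
    (2 * c * (n - 1) + d) * ∑ i, x i ≤ ∑ i, ∑ j, f i j := by
  have := sum_sum_le_of_pair_le (f := fun i j => -f i j) (x := x) (c := -c) (d := -d)
    (fun i j hij => by linarith [hne i j hij]) (fun i => by linarith [hd i])
  simp only [Finset.sum_neg_distrib] at this
  linarith
end

theorem mainTheorem6 {H : Type*} [NormedAddCommGroup H] [InnerProductSpace ℂ H] [CompleteSpace H]
    [TopologicalSpace.SeparableSpace H] (p : ℝ) (hp : 0 < p) (n : ℕ) (A : Fin n → H →L[ℂ] H)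
    (hA : ∀ i, A i ∈ schattenClass H p)
    (hort : ∀ i j, i ≠ j → (A i).range ⟂ (A j).range) :
    (∀ i j, A i + A j ∈ schattenClass H p ∧ A i - A j ∈ schattenClass H p) ∧
    (p ≤ 2 →
      ∑ i, ∑ j, schattenNorm p (A i + A j) ^ 2 ≤
          2 * (n : ℝ) ^ (2 / p - 1) * ((n : ℝ) + 1) * ∑ i, schattenNorm p (A i) ^ 2 ∧
      ∑ i, ∑ j, schattenNorm p (A i - A j) ^ 2 ≤
          2 * (n : ℝ) ^ (2 / p - 1) * ((n : ℝ) - 1) * ∑ i, schattenNorm p (A i) ^ 2) ∧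
    (2 ≤ p →
      2 * (n : ℝ) ^ (2 / p - 1) * ((n : ℝ) + 1) * ∑ i, schattenNorm p (A i) ^ 2 ≤
          ∑ i, ∑ j, schattenNorm p (A i + A j) ^ 2 ∧
      2 * (n : ℝ) ^ (2 / p - 1) * ((n : ℝ) - 1) * ∑ i, schattenNorm p (A i) ^ 2 ≤
          ∑ i, ∑ j, schattenNorm p (A i - A j) ^ 2) := by
  have hin : ∀ i j, i ≠ j → ∀ x y, inner ℂ (A i x) (A j y) = 0 := fun i j hij x y =>
    Submodule.isOrtho_iff_inner_eq.1 (hort i j hij) _ (LinearMap.mem_range_self _ x) _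
      (LinearMap.mem_range_self _ y)
  have hin' : ∀ i j, i ≠ j → ∀ x y, inner ℂ (A i x) ((-A j) y) = 0 := fun i j hij x y => by
    rw [neg_apply, inner_neg_right, hin i j hij, neg_zero]
  have hneg : ∀ j, schattenNorm p (-A j) = schattenNorm p (A j) := fun j => by
    rw [schattenNorm, schattenENorm_neg, schattenNorm]
  have hadd : ∀ i, schattenNorm p (A i + A i) ^ 2 = 4 * schattenNorm p (A i) ^ 2 := fun i => by
    rw [schattenNorm_add_self hp (hA i).1]
    ring
  have hsub : ∀ i, schattenNorm p (A i - A i) ^ 2 = 0 := fun i => by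
    rw [sub_self, schattenNorm_zero hp, sq, mul_zero]
  have htwo : ∀ i j : Fin n, i ≠ j → (2 : ℝ) ≤ n := fun i j hij => by
    have : 2 ≤ n := by
      have h1 := i.2
      have h2 := j.2
      have h3 := Fin.val_ne_of_ne hij
      omega
    exact_mod_cast this
  have hx : 0 ≤ ∑ i, schattenNorm p (A i) ^ 2 := Finset.sum_nonneg fun i _ => sq_nonneg _
  refine ⟨fun i j => ?_, fun hp2 => ?_, fun hp2 => ?_⟩
  · rcases eq_or_ne i j with rfl | hij
    · exact ⟨add_self_mem_schattenClass hp (hA i), by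
        rw [sub_self]
        exact zero_mem_schattenClass hp⟩
    · refine ⟨add_mem_schattenClass_of_inner_eq_zero hp (hA i) (hA j) (hin i j hij), ?_⟩
      rw [sub_eq_add_neg]
      exact add_mem_schattenClass_of_inner_eq_zero hp (hA i) (neg_mem_schattenClass (hA j))
        (hin' i j hij)
  · rcases Nat.eq_zero_or_pos n with rfl | hn
    · simp
    have hr : 0 ≤ 2 / p - 1 := by
      rw [sub_nonneg]
      exact (one_le_div hp).2 hp2
    have hc : 1 ≤ (n : ℝ) ^ (2 / p - 1) := Real.one_le_rpow (by exact_mod_cast hn) hr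
    have hle : ∀ i j : Fin n, i ≠ j → (2 : ℝ) ^ (2 / p - 1) ≤ (n : ℝ) ^ (2 / p - 1) :=
      fun i j hij => Real.rpow_le_rpow zero_le_two (htwo i j hij) hr
    constructor
    · refine (sum_sum_le_of_pair_le (x := fun i => schattenNorm p (A i) ^ 2)
        (c := (n : ℝ) ^ (2 / p - 1)) (d := 4) (fun i j hij => ?_) fun i => (hadd i).le).trans ?_
      · exact (schattenNorm_add_sq_le hp hp2 (hA i) (hA j) (hin i j hij)).trans
          (mul_le_mul_of_nonneg_right (hle i j hij) (by positivity))
      -- With `c = n ^ (2 / p - 1)`, `2c(n - 1) + 4 ≤ 2c(n + 1)` amounts to `1 ≤ c`.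
      · exact mul_le_mul_of_nonneg_right (by linarith) hx
    · refine (sum_sum_le_of_pair_le (x := fun i => schattenNorm p (A i) ^ 2)
        (c := (n : ℝ) ^ (2 / p - 1)) (d := 0) (fun i j hij => ?_)
        fun i => by rw [hsub, zero_mul]).trans ?_
      · rw [sub_eq_add_neg (A i), ← hneg j]
        exact (schattenNorm_add_sq_le hp hp2 (hA i) (neg_mem_schattenClass (hA j))
          (hin' i j hij)).trans (mul_le_mul_of_nonneg_right (hle i j hij) (by positivity))
      · rw [add_zero]
  · rcases Nat.eq_zero_or_pos n with rfl | hn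
    · simp
    have hr : 2 / p - 1 ≤ 0 := by
      rw [sub_nonpos]
      exact (div_le_one hp).2 hp2
    have hc : (n : ℝ) ^ (2 / p - 1) ≤ 1 :=
      Real.rpow_le_one_of_one_le_of_nonpos (by exact_mod_cast hn) hr
    have hle : ∀ i j : Fin n, i ≠ j → (n : ℝ) ^ (2 / p - 1) ≤ (2 : ℝ) ^ (2 / p - 1) :=
      fun i j hij => Real.rpow_le_rpow_of_nonpos zero_lt_two (htwo i j hij) hr
    constructor
    · refine le_trans ?_ (le_sum_sum_of_le_pair (x := fun i => schattenNorm p (A i) ^ 2)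
        (c := (n : ℝ) ^ (2 / p - 1)) (d := 4) (fun i j hij => ?_) fun i => (hadd i).ge)
      -- The reverse comparison, from `c ≤ 1`.
      · exact mul_le_mul_of_nonneg_right (by linarith) hx
      · exact (mul_le_mul_of_nonneg_right (hle i j hij) (by positivity)).trans
          (le_schattenNorm_add_sq hp2 (hA i) (hA j) (hin i j hij))
    · refine le_trans ?_ (le_sum_sum_of_le_pair (x := fun i => schattenNorm p (A i) ^ 2)
        (c := (n : ℝ) ^ (2 / p - 1)) (d := 0) (fun i j hij => ?_)
        fun i => by rw [hsub, zero_mul])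
      · rw [add_zero]
      · rw [sub_eq_add_neg (A i), ← hneg j]
        exact (mul_le_mul_of_nonneg_right (hle i j hij) (by positivity)).trans
          (le_schattenNorm_add_sq hp2 (hA i) (neg_mem_schattenClass (hA j)) (hin' i j hij))
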